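/- All graphs are finite and simple. For a graph $G$ let $\mathcal I(G)$ be the family of its independent sets. The fractional chromatic number $\chi_f(G)$ is the minimum of $\sum_{I\in\mathcal I(G)} y_I$ over all families of real numbers $y_I\ge 0$ $(I\in\mathcal I(G))$ such that $\sum_{I\in\mathcal I(G),\, v\in I} y_I\ge 1$ for every vertex $v\in V(G)$. Theorem. For every real number $x\ge 1$ there exists a real number $k(x)>0$ such that every graph $G$ with $\chi_f(G)\ge k(x)$ contains a triangle-free subgraph $H$ with $\chi_f(H)\ge x$. -/

import Mathlib

namespace FracChrom

open Classical in
/-- The family of all independent sets of the graph `G` on a finite vertex set. -/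
noncomputable def indepSets {V : Type*} [Fintype V] (G : SimpleGraph V) : Finset (Finset V) :=
  Finset.univ.filter fun I : Finset V => G.IsIndepSet (I : Set V)

open Classical in
/-- The set of total weights of fractional colorings of the graph `G` on a finite vertex set:
a fractional coloring gives each independent set `I` a weight `y I ≥ 0` such that, for each vertex
`v`, the independent sets containing `v` have total weight at least `1`.
(The values of `y` at sets that are not independent are never used.) -/
def fractionalColoringWeights {V : Type*} [Fintype V] (G : SimpleGraph V) : Set ℝ :=
  {s | ∃ y : Finset V → ℝ,
    (∀ I ∈ indepSets G, 0 ≤ y I) ∧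
    (∀ v : V, 1 ≤ ∑ I ∈ indepSets G with v ∈ I, y I) ∧
    s = ∑ I ∈ indepSets G, y I}

/-- The fractional chromatic number of a finite graph: the least total weight of a fractional
coloring. The least value exists, see `isLeast_fractionalChromaticNumber`. -/
noncomputable def fractionalChromaticNumber {V : Type*} [Finite V] (G : SimpleGraph V) : ℝ :=
  sInf (@fractionalColoringWeights V (Fintype.ofFinite V) G)

theorem fractionalColoringWeights_nonempty {V : Type*} [Fintype V] (G : SimpleGraph V) :
    (fractionalColoringWeights G).Nonempty := by
  classical
  refine ⟨_, fun _ => 1, fun _ _ => zero_le_one, fun v => ?_, rfl⟩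
  refine Finset.single_le_sum (f := fun _ : Finset V => (1 : ℝ)) (a := {v})
    (fun _ _ => zero_le_one) ?_
  simp [indepSets, SimpleGraph.IsIndepSet]

theorem fractionalColoringWeights_nonneg {V : Type*} [Fintype V] (G : SimpleGraph V)
    {s : ℝ} (hs : s ∈ fractionalColoringWeights G) : 0 ≤ s := by
  classical
  obtain ⟨y, h0, -, rfl⟩ := hs
  exact Finset.sum_nonneg fun I hI => h0 I hI

/-- The minimum in the definition of the fractional chromatic number is attained. -/
theorem isLeast_fractionalChromaticNumber {V : Type*} [Fintype V] (G : SimpleGraph V) :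
    IsLeast (fractionalColoringWeights G) (fractionalChromaticNumber G) := by
  classical
  have hdef : fractionalChromaticNumber G = sInf (fractionalColoringWeights G) := by
    unfold fractionalChromaticNumber
    congr!
  rw [hdef]
  have hne := fractionalColoringWeights_nonempty G
  have hbdd : BddBelow (fractionalColoringWeights G) :=
    ⟨0, fun s hs => fractionalColoringWeights_nonneg G hs⟩
  obtain ⟨M, hM⟩ := hne
  -- the feasible points with total weight at most `M` that vanish off the independent sets
  let F : (Finset V → ℝ) → ℝ := fun y => ∑ I ∈ indepSets G, y I
  let K : Set (Finset V → ℝ) :=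
    Set.Icc 0 (fun _ => M) ∩
      {y | ∀ v : V, 1 ≤ ∑ I ∈ indepSets G with v ∈ I, y I}
  have hK : IsCompact K := by
    refine isCompact_Icc.inter_right ?_
    simp only [Set.ofPred_forall]
    exact isClosed_iInter fun v => isClosed_le continuous_const (by fun_prop)
  have hF : ContinuousOn F K := by
    have : Continuous F := by fun_prop
    exact this.continuousOn
  have key : ∀ s ∈ fractionalColoringWeights G, s ≤ M → ∃ y ∈ K, F y = s := by
    rintro s ⟨y, h0, h1, rfl⟩ hs
    refine ⟨fun I => if I ∈ indepSets G then y I else 0, ⟨⟨?_, ?_⟩, ?_⟩, ?_⟩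
    · intro I
      by_cases hI : I ∈ indepSets G <;> simp [hI, h0]
    · intro I
      by_cases hI : I ∈ indepSets G
      · simp only [hI, if_true]
        refine le_trans ?_ hs
        exact Finset.single_le_sum (f := y) h0 hI
      · simpa [hI] using fractionalColoringWeights_nonneg G hM
    · intro v
      refine (h1 v).trans (le_of_eq (Finset.sum_congr rfl fun I hI => ?_))
      simp only [Finset.mem_filter] at hI
      simp [hI.1]
    · refine Finset.sum_congr rfl fun I hI => ?_
      simp [hI]
  obtain ⟨y₁, hy₁, -⟩ := key M hM le_rfl
  obtain ⟨y, hy, hmin⟩ := hK.exists_isMinOn ⟨y₁, hy₁⟩ hF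
  have hleast : IsLeast (fractionalColoringWeights G) (F y) := by
    refine ⟨⟨y, fun I _ => hy.1.1 I, hy.2, rfl⟩, fun s hs => ?_⟩
    rcases le_total s M with h | h
    · obtain ⟨z, hz, rfl⟩ := key s hs h
      exact hmin hz
    · obtain ⟨z, hz, hzM⟩ := key M hM le_rfl
      exact (hmin hz).trans (hzM.le.trans h)
  rw [hleast.csInf_eq]
  exact hleast

end FracChrom

/-! Suppose every triangle-free subgraph of G has fractional chromatic number at most x. A large
clique is then impossible, since it would contain `flagGraph p`, which is triangle-free with
fractional chromatic number at least p/2. It remains to bound χ_f in terms of x and the clique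
number; by induction on the latter, it suffices to do so when neighborhoods are boundedly colorable
(`exists_fracCoverable_of_neighborhoods`).

There, LP duality turns the bound into a search for a heavy independent set, and vertices are
ordered by decreasing weight. Each vertex v draws a random color class f v from a fractional
coloring of its lower neighborhood. Keeping only the lower edges into f v leaves a triangle-free
graph, hence a set S independent in it with at least 1/x of the weight. Greedily take R ⊆ S so that
lower neighborhoods inside R are cheaper to color by a factor q > 1. If R has half the weight of S,
recurse on R. Otherwise S \ R is dense in some initial segment; its vertices have expensive lower
neighborhoods in R, which the random classes very probably hit, giving a kept edge inside S. A union
bound makes one choice work for all segments (`exists_selection`). -/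

namespace FracChrom
open scoped Classical

universe u

/-! ### Fractional colorings of vertex sets, averaging and duality -/

section Coverable

variable {V : Type u} [Fintype V]

/-- The vertices of `A` can be fractionally colored in `G` with total weight `c`. -/
def FracCoverable (G : SimpleGraph V) (A : Finset V) (c : ℝ) : Prop :=
  ∃ y : Finset V → ℝ, (∀ I, 0 ≤ y I) ∧ (∀ I, y I ≠ 0 → G.IsIndepSet (I : Set V)) ∧
    (∀ v ∈ A, 1 ≤ ∑ I with v ∈ I, y I) ∧ ∑ I, y I = c

/-- Surplus weight can be put on the empty set, so the equality in `FracCoverable` costs nothing. -/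
theorem FracCoverable.mono {G : SimpleGraph V} {A : Finset V} {c d : ℝ}
    (h : FracCoverable G A c) (hcd : c ≤ d) : FracCoverable G A d := by
  obtain ⟨y, h0, hi, h1, hs⟩ := h
  have hle : ∀ I, y I ≤ y I + if I = ∅ then d - c else 0 := fun I => by
    split_ifs <;> linarith
  refine ⟨fun I => y I + if I = ∅ then d - c else 0, fun I => (h0 I).trans (hle I), ?_,
    fun v hv => (h1 v hv).trans (Finset.sum_le_sum fun I _ => hle I), ?_⟩
  · intro I hI
    by_cases hI' : I = ∅
    · simp [hI', SimpleGraph.IsIndepSet]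
    · exact hi I (by simpa [hI'] using hI)
  · rw [Finset.sum_add_distrib, hs]
    simp

theorem FracCoverable.one_le {G : SimpleGraph V} {A : Finset V} {c : ℝ}
    (h : FracCoverable G A c) {v : V} (hv : v ∈ A) : 1 ≤ c := by
  obtain ⟨y, h0, -, h1, rfl⟩ := h
  exact (h1 v hv).trans (Finset.sum_le_univ_sum_of_nonneg h0)

theorem FracCoverable.subset {G : SimpleGraph V} {A B : Finset V} {c : ℝ}
    (h : FracCoverable G A c) (hBA : B ⊆ A) : FracCoverable G B c := by
  obtain ⟨y, h0, hi, h1, hs⟩ := h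
  exact ⟨y, h0, hi, fun v hv => h1 v (hBA hv), hs⟩

theorem fracCoverable_empty (G : SimpleGraph V) {c : ℝ} (hc : 0 ≤ c) :
    FracCoverable G ∅ c :=
  FracCoverable.mono (c := 0) ⟨fun _ => 0, by simp, by simp, by simp, by simp⟩ hc

theorem fracCoverable_fractionalChromaticNumber (G : SimpleGraph V) :
    FracCoverable G Finset.univ (fractionalChromaticNumber G) := by
  obtain ⟨y, h0, h1, hs⟩ := (isLeast_fractionalChromaticNumber G).1
  refine ⟨fun I => if I ∈ indepSets G then y I else 0, ?_, ?_, ?_, ?_⟩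
  · intro I
    by_cases hI : I ∈ indepSets G <;> simp [hI, h0]
  · intro I hI
    have : I ∈ indepSets G := by
      by_contra h
      simp [h] at hI
    simpa [indepSets] using this
  · intro v _
    refine (h1 v).trans (le_of_eq ?_)
    rw [← Finset.sum_filter, Finset.filter_filter]
    refine Finset.sum_congr ?_ fun _ _ => rfl
    ext I
    simp [and_comm]
  · rw [hs, Finset.sum_ite_mem, Finset.univ_inter]

theorem FracCoverable.fractionalChromaticNumber_le {G : SimpleGraph V} {c : ℝ}
    (h : FracCoverable G Finset.univ c) : fractionalChromaticNumber G ≤ c := by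
  obtain ⟨y, h0, hi, h1, rfl⟩ := h
  have hz : ∀ I, I ∉ indepSets G → y I = 0 := fun I hI => by
    by_contra h
    exact hI (by simpa [indepSets] using hi I h)
  refine (isLeast_fractionalChromaticNumber G).2 ⟨y, fun I _ => h0 I, fun v => ?_, ?_⟩
  · refine (h1 v (Finset.mem_univ v)).trans (le_of_eq ?_)
    symm
    refine Finset.sum_subset (Finset.filter_subset_filter _ (Finset.subset_univ _)) ?_
    intro I hI hI'
    refine hz I fun h => hI' ?_
    simp only [Finset.mem_filter] at hI ⊢
    exact ⟨h, hI.2⟩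
  · exact (Finset.sum_subset (Finset.subset_univ _) fun I _ hI => hz I hI).symm

/-- Fractional colorings pull back along injective graph homomorphisms. -/
theorem FracCoverable.of_injective {W : Type*} [Fintype W] {F : SimpleGraph W}
    {G : SimpleGraph V} {c : ℝ} (h : FracCoverable G Finset.univ c) (f : W → V)
    (hf : ∀ a b, F.Adj a b → G.Adj (f a) (f b)) : FracCoverable F Finset.univ c := by
  obtain ⟨y, h0, hi, h1, hs⟩ := h
  refine ⟨fun J => ∑ I with (Finset.univ.filter fun a => f a ∈ I) = J, y I,
    fun J => Finset.sum_nonneg fun I _ => h0 I, ?_, ?_, ?_⟩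
  · intro J hJ
    obtain ⟨I, hI, hyI⟩ := Finset.exists_ne_zero_of_sum_ne_zero hJ
    simp only [Finset.mem_filter, Finset.mem_univ, true_and] at hI
    subst hI
    intro a ha b hb hab hadj
    simp only [Finset.coe_filter, Finset.mem_univ, true_and, Set.mem_ofPred_eq] at ha hb
    exact hi I hyI ha hb (hf a b hadj).ne (hf a b hadj)
  · intro a _
    refine (h1 (f a) (Finset.mem_univ _)).trans (le_of_eq ?_)
    rw [Finset.sum_filter, Finset.sum_filter]
    simp only [Finset.sum_filter]
    have : ∀ J : Finset W, (if a ∈ J then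
        ∑ I, (if (Finset.univ.filter fun a => f a ∈ I) = J then y I else 0) else 0) =
        ∑ I, if (Finset.univ.filter fun a => f a ∈ I) = J then
          (if f a ∈ I then y I else 0) else 0 := by
      intro J
      split_ifs with hJ
      · refine Finset.sum_congr rfl fun I _ => ?_
        split_ifs with h2 h3 <;> subst_vars <;> simp_all
      · symm
        refine Finset.sum_eq_zero fun I _ => ?_
        split_ifs with h2 h3 <;> subst_vars <;> simp_all
    rw [Finset.sum_congr rfl fun J _ => this J, Finset.sum_comm]
    simp
  · rw [← hs]
    exact Finset.sum_fiberwise _ _ _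

/-- Averaging: a fractional coloring yields an independent set of large weight. -/
theorem FracCoverable.exists_weight_le {G : SimpleGraph V} {A : Finset V} {c : ℝ}
    (h : FracCoverable G A c) (w : V → ℝ) (hw : ∀ v, 0 ≤ w v) :
    ∃ I : Finset V, I ⊆ A ∧ G.IsIndepSet (I : Set V) ∧ ∑ v ∈ A, w v ≤ c * ∑ v ∈ I, w v := by
  obtain ⟨y, h0, hi, h1, rfl⟩ := h
  by_contra! hcon
  -- The negated claim is applied to each trace A ∩ I and averaged with the weights y I.
  have key : ∀ I, y I * (∑ J, y J) * ∑ v ∈ A ∩ I, w v ≤ y I * ∑ v ∈ A, w v := by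
    intro I
    by_cases hy : y I = 0
    · simp [hy]
    · rw [mul_assoc]
      refine mul_le_mul_of_nonneg_left (hcon _ Finset.inter_subset_left ?_).le (h0 I)
      exact (hi I hy).mono (by simp)
  have hA : 0 < ∑ v ∈ A, w v := by
    have := hcon ∅ (by simp) (by simp [SimpleGraph.IsIndepSet])
    simpa using this
  have hpos : ∃ I, y I ≠ 0 := by
    obtain ⟨v, hv, -⟩ := Finset.exists_ne_zero_of_sum_ne_zero hA.ne'
    by_contra! hz
    have := h1 v hv
    simp [hz] at this
    linarith
  obtain ⟨I₀, hI₀⟩ := hpos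
  have hlt : ∑ I, y I * (∑ J, y J) * ∑ v ∈ A ∩ I, w v < ∑ I, y I * ∑ v ∈ A, w v := by
    refine Finset.sum_lt_sum (fun I _ => key I) ⟨I₀, Finset.mem_univ _, ?_⟩
    rw [mul_assoc]
    refine mul_lt_mul_of_pos_left (hcon _ Finset.inter_subset_left ?_)
      (lt_of_le_of_ne (h0 I₀) (Ne.symm hI₀))
    exact (hi I₀ hI₀).mono (by simp)
  have hge : ∑ v ∈ A, w v ≤ ∑ I, y I * ∑ v ∈ A ∩ I, w v := by
    calc ∑ v ∈ A, w v ≤ ∑ v ∈ A, w v * ∑ I with v ∈ I, y I :=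
          Finset.sum_le_sum fun v hv => le_mul_of_one_le_right (hw v) (h1 v hv)
      _ = ∑ I, y I * ∑ v ∈ A ∩ I, w v := by
          simp only [Finset.mul_sum, Finset.sum_filter, ← Finset.filter_mem_eq_inter]
          rw [Finset.sum_comm]
          refine Finset.sum_congr rfl fun I _ => Finset.sum_congr rfl fun v _ => ?_
          split_ifs <;> ring
  have hc : 0 ≤ ∑ J, y J := Finset.sum_nonneg fun I _ => h0 I
  have h2 : ∑ I, y I * (∑ J, y J) * ∑ v ∈ A ∩ I, w v =
      (∑ J, y J) * ∑ I, y I * ∑ v ∈ A ∩ I, w v := by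
    rw [Finset.mul_sum]
    exact Finset.sum_congr rfl fun I _ => by ring
  rw [h2, ← Finset.sum_mul] at hlt
  exact absurd (mul_le_mul_of_nonneg_left hge hc) (not_le.mpr hlt)

/-- Linear programming duality: if `A` has no fractional coloring of weight `k`, then there is a
weight function for which every independent set has less than a `k`-th part of the weight. -/
theorem exists_weight_of_not_fracCoverable {G : SimpleGraph V} {A : Finset V} {k : ℝ}
    (hk : 0 < k) (h : ¬ FracCoverable G A k) :
    ∃ w : V → ℝ, (∀ v, 0 ≤ w v) ∧
      ∀ I : Finset V, G.IsIndepSet (I : Set V) → k * ∑ v ∈ I, w v < ∑ v ∈ A, w v := by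
  let ι := {I : Finset V // G.IsIndepSet (I : Set V)}
  -- L sends a probability vector on independent sets to the coverage by k times that vector. Not
  -- being coverable means that the image of the simplex misses the set D of coverages sufficient
  -- for A.
  let L : (ι → ℝ) →ₗ[ℝ] (V → ℝ) :=
    Fintype.linearCombination ℝ fun (I : ι) v => if v ∈ I.1 then k else 0
  have hL : ∀ y v, L y v = ∑ I : ι, if v ∈ I.1 then y I * k else 0 := by
    intro y v
    simp [L, Fintype.linearCombination_apply, Finset.sum_apply]
  let D : Set (V → ℝ) := {z | ∀ v ∈ A, 1 ≤ z v}
  have hD : Convex ℝ D := by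
    intro z hz z' hz' a b ha hb hab v hv
    have h1 := hz v hv
    have h2 := hz' v hv
    simp only [Pi.add_apply, Pi.smul_apply, smul_eq_mul]
    nlinarith
  have hDc : IsClosed D := by
    have : D = ⋂ v ∈ A, {z | 1 ≤ z v} := by ext; simp [D]
    rw [this]
    exact isClosed_biInter fun v _ => isClosed_le continuous_const (continuous_apply v)
  have hsub : ∀ F : Finset V → ℝ, (∀ I : Finset V, ¬ G.IsIndepSet (I : Set V) → F I = 0) →
      ∑ I : ι, F I.1 = ∑ I, F I := by
    intro F hF
    have h0 : ∑ I : {I : Finset V // ¬ G.IsIndepSet (I : Set V)}, F I.1 = 0 :=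
      Finset.sum_eq_zero fun I _ => hF I.1 I.2
    rw [← Fintype.sum_subtype_add_sum_subtype (fun I : Finset V => G.IsIndepSet (I : Set V)) F,
      h0, add_zero]
  have hdisj : Disjoint (L '' stdSimplex ℝ ι) D := by
    rw [Set.disjoint_left]
    rintro _ ⟨y, ⟨hy0, hy1⟩, rfl⟩ hyD
    refine h ⟨fun I => if hI : G.IsIndepSet (I : Set V) then y ⟨I, hI⟩ * k else 0, ?_, ?_, ?_, ?_⟩
    · intro I
      by_cases hI : G.IsIndepSet (I : Set V)
      · simpa [hI] using mul_nonneg (hy0 _) hk.le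
      · simp [hI]
    · intro I hI
      by_contra hI'
      simp [hI'] at hI
    · intro v hv
      refine (hyD v hv).trans (le_of_eq ?_)
      rw [hL, Finset.sum_filter, ← hsub _ fun I hI => by simp [hI]]
      exact Finset.sum_congr rfl fun I _ => by simp [I.2]
    · rw [← hsub _ fun I hI => by simp [hI], ← one_mul k]
      nth_rw 2 [← hy1]
      rw [Finset.sum_mul]
      exact Finset.sum_congr rfl fun I _ => by simp [I.2]
  obtain ⟨f, s, t, hs, hst, ht⟩ := geometric_hahn_banach_compact_closed
    ((convex_stdSimplex ℝ ι).linear_image L)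
    ((isCompact_stdSimplex ℝ ι).image L.continuous_of_finiteDimensional) hD hDc hdisj
  have hf : ∀ (B : Finset V) (c : ℝ), f (fun v => if v ∈ B then c else 0) =
      c * ∑ v ∈ B, f (Pi.single v 1) := by
    intro B c
    have : (fun v => if v ∈ B then c else 0) = ∑ v ∈ B, c • (Pi.single v 1 : V → ℝ) := by
      ext u
      simp [Finset.sum_apply, Pi.single_apply]
    rw [this, map_sum, Finset.mul_sum]
    simp
  refine ⟨fun v => f (Pi.single v 1), fun v => ?_, fun I hI => ?_⟩
  · by_contra! hv
    -- D is closed upward, so a negative coefficient would push f below its lower bound t on D.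
    have h1 : ∀ a : ℝ, 0 ≤ a → t < f 1 + a * f (Pi.single v 1) := by
      intro a ha
      have := ht (1 + a • Pi.single v 1) (fun u _ => by
        simp only [Pi.add_apply, Pi.one_apply, Pi.smul_apply, smul_eq_mul, Pi.single_apply]
        split_ifs <;> simp [ha])
      simpa using this
    have h2 := h1 ((f 1 - t) / -f (Pi.single v 1))
      (div_nonneg (by simpa using (h1 0 le_rfl).le) (by linarith))
    have h3 : (f 1 - t) / -f (Pi.single v 1) * f (Pi.single v 1) = -(f 1 - t) := by
      field_simp [hv.ne]
    linarith
  · have h1 := hs (fun v => if v ∈ I then k else 0) ⟨Pi.single ⟨I, hI⟩ 1,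
      single_mem_stdSimplex ℝ _, by
        ext v
        simp [L]⟩
    have h2 := ht (fun v => if v ∈ A then 1 else 0) fun v hv => by simp [hv]
    rw [hf] at h1 h2
    linarith

end Coverable

/-! ### Union bound for product distributions -/

/-- A finite union bound for independent random choices: if the probabilities of the bad events
sum to less than one, then some choice in the support of the distributions avoids them all. -/
theorem exists_forall_exists_notMem {V β τ : Type*} [Fintype V] [Fintype β]
    (p : V → β → ℝ) (hp0 : ∀ v b, 0 ≤ p v b) (hp1 : ∀ v, ∑ b, p v b = 1)
    (T : Finset τ) (Q : τ → Finset V) (B : τ → V → Finset β)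
    (h : ∑ t ∈ T, ∏ v ∈ Q t, ∑ b ∈ B t v, p v b < 1) :
    ∃ f : V → β, (∀ v, p v (f v) ≠ 0) ∧ ∀ t ∈ T, ∃ v ∈ Q t, f v ∉ B t v := by
  by_contra! hcon
  have hsum : ∀ q : V → β → ℝ, ∏ v, ∑ b, q v b = ∑ f : V → β, ∏ v, q v (f v) := by
    intro q
    rw [Finset.prod_univ_sum, Fintype.piFinset_univ]
  let q : τ → V → β → ℝ := fun t v b => if v ∈ Q t → b ∈ B t v then p v b else 0
  have hq0 : ∀ t v b, 0 ≤ q t v b := fun t v b => by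
    simp only [q]
    split_ifs
    exacts [hp0 v b, le_rfl]
  have hq : ∀ t, ∏ v, ∑ b, q t v b = ∏ v ∈ Q t, ∑ b ∈ B t v, p v b := by
    intro t
    rw [← Finset.prod_subset (Finset.subset_univ (Q t))]
    · refine Finset.prod_congr rfl fun v hv => ?_
      simp [q, hv]
    · intro v _ hv
      simp [q, hv, hp1]
  -- A choice in the support lies in some bad event; any other choice has mass zero.
  have h1 : ∀ f : V → β, ∏ v, p v (f v) ≤ ∑ t ∈ T, ∏ v, q t v (f v) := by
    intro f
    by_cases hf : ∀ v, p v (f v) ≠ 0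
    · obtain ⟨t, ht, htf⟩ := hcon f hf
      have h2 : ∏ v, p v (f v) = ∏ v, q t v (f v) :=
        Finset.prod_congr rfl fun v _ => (if_pos (htf v)).symm
      rw [h2]
      exact Finset.single_le_sum (f := fun t => ∏ v, q t v (f v))
        (fun t _ => Finset.prod_nonneg fun v _ => hq0 t v _) ht
    · push Not at hf
      obtain ⟨v, hv⟩ := hf
      rw [Finset.prod_eq_zero (Finset.mem_univ v) hv]
      exact Finset.sum_nonneg fun t _ => Finset.prod_nonneg fun v _ => hq0 t v _
  have h2 : (1 : ℝ) ≤ ∑ t ∈ T, ∏ v ∈ Q t, ∑ b ∈ B t v, p v b := by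
    calc (1 : ℝ) = ∏ v, ∑ b, p v b := by simp [hp1]
      _ = ∑ f : V → β, ∏ v, p v (f v) := hsum p
      _ ≤ ∑ f : V → β, ∑ t ∈ T, ∏ v, q t v (f v) := Finset.sum_le_sum fun f _ => h1 f
      _ = ∑ t ∈ T, ∏ v ∈ Q t, ∑ b ∈ B t v, p v b := by
        rw [Finset.sum_comm]
        exact Finset.sum_congr rfl fun t _ => by rw [← hsum, hq]
  linarith

/-! ### Initial segments and greedy subsets -/

section Rank

variable {V : Type u} {α : Type*} [LinearOrder α] (r : V → α)

/-- The members of `A` of rank at most that of `a`. -/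
noncomputable def below (A : Finset V) (a : V) : Finset V := A.filter fun b => r b ≤ r a

/-- Abel summation: against decreasing nonnegative weights, a function with nonpositive initial
sums has nonpositive sum. -/
theorem sum_mul_le_mul_sum (hr : Function.Injective r) (w f : V → ℝ)
    (hw : ∀ u v, r u ≤ r v → w v ≤ w u) (A : Finset V)
    (hf : ∀ a ∈ A, ∑ b ∈ below r A a, f b ≤ 0) :
    ∀ c, (∀ a ∈ A, c ≤ w a) → ∑ b ∈ A, w b * f b ≤ c * ∑ b ∈ A, f b := by
  induction A using Finset.induction_on_max_value r with
  | empty => simp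
  | insert a s ha hmax ih =>
    intro c hc
    have hs : ∀ b ∈ s, below r (insert a s) b = below r s b := by
      intro b hb
      have : r b < r a := lt_of_le_of_ne (hmax b hb) fun h => ha (hr h ▸ hb)
      rw [below, Finset.filter_insert, if_neg (not_le.mpr this), below]
    have hall : below r (insert a s) a = insert a s := by
      rw [below, Finset.filter_true_of_mem]
      intro b hb
      rcases Finset.mem_insert.mp hb with rfl | hb
      exacts [le_rfl, hmax b hb]
    -- The constant is generalized so that it can be the last weight w a here; since the full sum of
    -- f is nonpositive, w a may then be lowered to c.
    have h1 := ih (fun b hb => hs b hb ▸ hf b (Finset.mem_insert_of_mem hb)) (w a)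
      fun b hb => hw b a (hmax b hb)
    have h2 := hf a (Finset.mem_insert_self a s)
    rw [hall] at h2
    have h3 := hc a (Finset.mem_insert_self a s)
    rw [Finset.sum_insert ha] at h2 ⊢
    rw [Finset.sum_insert ha]
    nlinarith

/-- The initial segments have sizes 1, ..., |A|, so this is a geometric sum below 1/3. -/
theorem sum_pow_card_below_lt_one (hr : Function.Injective r) (A : Finset V) :
    ∑ a ∈ A, (1 / 4 : ℝ) ^ (below r A a).card < 1 := by
  have : ∑ a ∈ A, (1 / 4 : ℝ) ^ (below r A a).card = (1 - (1 / 4) ^ A.card) / 3 := by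
    induction A using Finset.induction_on_max_value r with
    | empty => simp
    | insert a s ha hmax ih =>
      have hs : ∀ b ∈ s, below r (insert a s) b = below r s b := by
        intro b hb
        have : r b < r a := lt_of_le_of_ne (hmax b hb) fun h => ha (hr h ▸ hb)
        rw [below, Finset.filter_insert, if_neg (not_le.mpr this), below]
      have hall : below r (insert a s) a = insert a s := by
        rw [below, Finset.filter_true_of_mem]
        intro b hb
        rcases Finset.mem_insert.mp hb with rfl | hb
        exacts [le_rfl, hmax b hb]
      rw [Finset.sum_insert ha, hall, Finset.sum_congr rfl fun b hb => by rw [hs b hb], ih,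
        Finset.card_insert_of_notMem ha]
      ring
  rw [this]
  have : (0 : ℝ) < (1 / 4) ^ A.card := by positivity
  linarith

/-- The greedy subset determined by a property of vertices relative to sets of lower rank. -/
theorem exists_greedy (P : V → Finset V → Prop) (S : Finset V) :
    ∃ R ⊆ S, (∀ v ∈ R, P v (R.filter fun u => r u < r v)) ∧
      ∀ v ∈ S, v ∉ R → ¬ P v (R.filter fun u => r u < r v) := by
  induction S using Finset.induction_on_max_value r with
  | empty => exact ⟨∅, by simp⟩
  | insert a s ha hmax ih =>
    obtain ⟨R, hRs, h1, h2⟩ := ih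
    by_cases hP : P a (R.filter fun u => r u < r a)
    · have hR : ∀ v ∈ insert a s, ((insert a R).filter fun u => r u < r v) =
          R.filter fun u => r u < r v := by
        intro v hv
        rw [Finset.filter_insert, if_neg]
        rw [not_lt]
        rcases Finset.mem_insert.mp hv with rfl | hv
        exacts [le_rfl, hmax v hv]
      refine ⟨insert a R, Finset.insert_subset_insert a hRs, ?_, ?_⟩
      · intro v hv
        rw [hR v (Finset.insert_subset_insert a hRs hv)]
        rcases Finset.mem_insert.mp hv with rfl | hv
        exacts [hP, h1 v hv]
      · intro v hv hvR
        rw [hR v hv]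
        simp only [Finset.mem_insert, not_or] at hv hvR
        exact h2 v (hv.resolve_left hvR.1) hvR.2
    · refine ⟨R, hRs.trans (Finset.subset_insert a s), h1, fun v hv hvR => ?_⟩
      rcases Finset.mem_insert.mp hv with rfl | hv
      exacts [hP, h2 v hv hvR]

end Rank

/-! ### A triangle-free graph of large fractional chromatic number -/

/-- The graph on triples over `ZMod p` (thought of as a point `(a, b)` on the line of slope `m`)
in which `(a, b, m)` is joined to `(a', b', m')` for `a < a'` if `(a', b')` lies on the first line
and `m ≠ m'`. -/
def flagGraph (p : ℕ) [NeZero p] : SimpleGraph (ZMod p × ZMod p × ZMod p) :=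
  SimpleGraph.fromRel fun s t => s.1.val < t.1.val ∧
    t.2.1 = s.2.1 + s.2.2 * (t.1 - s.1) ∧ s.2.2 ≠ t.2.2

theorem flagGraph_adj_of_val_lt {p : ℕ} [NeZero p] {s t : ZMod p × ZMod p × ZMod p}
    (h : s.1.val < t.1.val) : (flagGraph p).Adj s t ↔
      t.2.1 = s.2.1 + s.2.2 * (t.1 - s.1) ∧ s.2.2 ≠ t.2.2 := by
  rw [flagGraph, SimpleGraph.fromRel_adj]
  constructor
  · rintro ⟨-, h' | h'⟩
    exacts [h'.2, absurd h'.1 h.le.not_gt]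
  · intro h'
    exact ⟨fun e => h.ne (e ▸ rfl), Or.inl ⟨h, h'⟩⟩

theorem flagGraph_val_ne {p : ℕ} [NeZero p] {s t : ZMod p × ZMod p × ZMod p}
    (h : (flagGraph p).Adj s t) : s.1.val ≠ t.1.val := by
  rw [flagGraph, SimpleGraph.fromRel_adj] at h
  rcases h.2 with h' | h'
  exacts [h'.1.ne, h'.1.ne']

/-- The lines of s and t both pass through the points of t and u, which have different abscissas;
but their slopes differ. -/
theorem flagGraph_not_triangle {p : ℕ} [Fact p.Prime] {s t u : ZMod p × ZMod p × ZMod p}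
    (hst : s.1.val < t.1.val) (htu : t.1.val < u.1.val) (h1 : (flagGraph p).Adj s t)
    (h2 : (flagGraph p).Adj s u) (h3 : (flagGraph p).Adj t u) : False := by
  rw [flagGraph_adj_of_val_lt hst] at h1
  rw [flagGraph_adj_of_val_lt (hst.trans htu)] at h2
  rw [flagGraph_adj_of_val_lt htu] at h3
  have h4 : (s.2.2 - t.2.2) * (u.1 - t.1) = 0 := by
    linear_combination h3.1 - h2.1 + h1.1
  rcases mul_eq_zero.mp h4 with h | h
  · exact h1.2 (sub_eq_zero.mp h)
  · exact htu.ne (congrArg ZMod.val (sub_eq_zero.mp h).symm)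

theorem flagGraph_cliqueFree (p : ℕ) [Fact p.Prime] : (flagGraph p).CliqueFree 3 := by
  intro K hK
  obtain ⟨a, b, c, hab, hac, hbc, -⟩ := SimpleGraph.is3Clique_iff.mp hK
  rcases lt_or_gt_of_ne (flagGraph_val_ne hab) with h1 | h1 <;>
  rcases lt_or_gt_of_ne (flagGraph_val_ne hac) with h2 | h2 <;>
  rcases lt_or_gt_of_ne (flagGraph_val_ne hbc) with h3 | h3
  · exact flagGraph_not_triangle h1 h3 hab hac hbc
  · exact flagGraph_not_triangle h2 h3 hac hab hbc.symm
  · omega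
  · exact flagGraph_not_triangle h2 h1 hac.symm hbc.symm hab
  · exact flagGraph_not_triangle h1 h2 hab.symm hbc hac
  · omega
  · exact flagGraph_not_triangle h3 h2 hbc hab.symm hac.symm
  · exact flagGraph_not_triangle h3 h1 hbc.symm hac.symm hab.symm

/-- Let B be the members of A whose point also carries another slope in A. Each line has at most one
member of B: an earlier one would be adjacent to the other-slope partner of a later one. Each point
has at most one member of A \ B. There are p² lines and p² points. -/
theorem flagGraph_card_le (p : ℕ) [Fact p.Prime] (A : Finset (ZMod p × ZMod p × ZMod p))
    (hA : (flagGraph p).IsIndepSet (A : Set _)) : A.card ≤ 2 * p ^ 2 := by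
  let B := A.filter fun s => ∃ t ∈ A, t.1 = s.1 ∧ t.2.1 = s.2.1 ∧ t.2.2 ≠ s.2.2
  have key : ∀ s ∈ B, ∀ t ∈ B, s.2.2 = t.2.2 →
      s.2.1 - s.2.2 * s.1 = t.2.1 - t.2.2 * t.1 → ¬ s.1.val < t.1.val := by
    intro s hs t ht h1 h2 hlt
    obtain ⟨u, huA, hu1, hu2, hu3⟩ := (Finset.mem_filter.mp ht).2
    have hadj : (flagGraph p).Adj s u := by
      rw [flagGraph_adj_of_val_lt (hu1 ▸ hlt), hu1, hu2]
      refine ⟨?_, fun e => hu3 (e ▸ h1)⟩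
      rw [← h1] at h2
      linear_combination -h2
    exact hA (Finset.mem_filter.mp hs).1 huA hadj.ne hadj
  have hcard : ∀ C : Finset (ZMod p × ZMod p), C.card ≤ p ^ 2 := by
    intro C
    refine (Finset.card_le_univ C).trans (le_of_eq ?_)
    rw [Fintype.card_prod, ZMod.card, sq]
  have hB : B.card ≤ p ^ 2 := by
    refine le_trans (le_of_eq ?_) (hcard (B.image fun s => (s.2.2, s.2.1 - s.2.2 * s.1)))
    refine (Finset.card_image_of_injOn ?_).symm
    intro s hs t ht hst
    simp only [Prod.mk.injEq] at hst
    obtain ⟨h1, h2⟩ := hst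
    have h3 : s.1 = t.1 := by
      refine ZMod.val_injective p (le_antisymm ?_ ?_)
      · exact not_lt.mp (key t ht s hs h1.symm h2.symm)
      · exact not_lt.mp (key s hs t ht h1 h2)
    refine Prod.ext h3 (Prod.ext ?_ h1)
    rw [h1, h3] at h2
    exact sub_left_inj.mp h2
  have hC : (A \ B).card ≤ p ^ 2 := by
    refine le_trans (le_of_eq ?_) (hcard ((A \ B).image fun s => (s.1, s.2.1)))
    refine (Finset.card_image_of_injOn ?_).symm
    intro s hs t ht hst
    simp only [Prod.mk.injEq] at hst
    refine Prod.ext hst.1 (Prod.ext hst.2 ?_)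
    by_contra hne
    simp only [Finset.coe_sdiff, Set.mem_sdiff, Finset.mem_coe] at hs ht
    exact hs.2 (Finset.mem_filter.mpr
      ⟨hs.1, t, ht.1, hst.1.symm, hst.2.symm, fun e => hne e.symm⟩)
  have : (A \ B).card + B.card = A.card :=
    Finset.card_sdiff_add_card_eq_card (Finset.filter_subset _ A)
  omega

/-! ### Random selection of lower neighbors -/

section Selection

variable {V : Type u} {α : Type*} [LinearOrder α]

/-- The neighbors of `v` in `A` that have lower rank than `v`. -/
noncomputable def lowerNbrs (G : SimpleGraph V) (r : V → α) (A : Finset V) (v : V) : Finset V :=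
  (A.filter fun u => r u < r v).filter fun u => G.Adj v u

/-- The subgraph of `G` that keeps, at each vertex `v`, only the edges to those neighbors of lower
rank that are selected by `f v`. -/
def selectGraph (G : SimpleGraph V) (r : V → α) (f : V → Finset V) : SimpleGraph V where
  Adj a b := G.Adj a b ∧ (r b < r a ∧ b ∈ f a ∨ r a < r b ∧ a ∈ f b)
  symm := ⟨fun _ _ h => ⟨h.1.symm, h.2.symm⟩⟩
  loopless := ⟨fun _ h => G.loopless.irrefl _ h.1⟩

theorem selectGraph_le (G : SimpleGraph V) (r : V → α) (f : V → Finset V) :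
    selectGraph G r f ≤ G := fun _ _ h => h.1

/-- The top vertex of a triangle would have selected both other vertices, which are adjacent in G.
-/
theorem selectGraph_cliqueFree {G : SimpleGraph V} {r : V → α} {f : V → Finset V}
    (hf : ∀ v, G.IsIndepSet (f v : Set V)) : (selectGraph G r f).CliqueFree 3 := by
  have key : ∀ a b c, (selectGraph G r f).Adj a b → (selectGraph G r f).Adj a c →
      (selectGraph G r f).Adj b c → r b < r a → r c < r a → False := by
    intro a b c hab hac hbc h1 h2
    have hb : b ∈ f a := (hab.2.resolve_right fun h => lt_asymm h1 h.1).2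
    have hc : c ∈ f a := (hac.2.resolve_right fun h => lt_asymm h2 h.1).2
    exact hf a hb hc hbc.ne hbc.1
  have hne : ∀ a b, (selectGraph G r f).Adj a b → r a < r b ∨ r b < r a := fun a b h =>
    h.2.elim (fun h => Or.inr h.1) fun h => Or.inl h.1
  intro K hK
  obtain ⟨a, b, c, hab, hac, hbc, -⟩ := SimpleGraph.is3Clique_iff.mp hK
  rcases hne a b hab with h1 | h1
  · rcases hne b c hbc with h2 | h2
    · exact key c a b hac.symm hbc.symm hab (h1.trans h2) h2
    · exact key b a c hab.symm hbc hac h1 h2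
  · rcases hne a c hac with h2 | h2
    · exact key c a b hac.symm hbc.symm hab h2 (h1.trans h2)
    · exact key a b c hab hac hbc h1 h2

variable [Fintype V]

/-- In a fractional coloring, a set that is not fractionally colorable with weight `c` is missed
by color classes of small total weight. -/
theorem sum_disjoint_le {G : SimpleGraph V} {L : Finset V} {c : ℝ} {y : Finset V → ℝ}
    (h0 : ∀ I, 0 ≤ y I) (hi : ∀ I, y I ≠ 0 → G.IsIndepSet (I : Set V))
    (h1 : ∀ v ∈ L, 1 ≤ ∑ I with v ∈ I, y I) (hL : ¬ FracCoverable G L c) :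
    ∑ I with Disjoint I L, y I ≤ ∑ I, y I - c := by
  have hcov : FracCoverable G L (∑ I with ¬ Disjoint I L, y I) := by
    refine ⟨fun I => if ¬ Disjoint I L then y I else 0, ?_, ?_, ?_, ?_⟩
    · intro I
      dsimp only
      split_ifs
      exacts [le_rfl, h0 I]
    · intro I hI
      refine hi I fun h => hI ?_
      simp [h]
    · intro v hv
      refine (h1 v hv).trans (le_of_eq (Finset.sum_congr rfl fun I hI => (if_pos ?_).symm))
      exact Finset.not_disjoint_iff.mpr ⟨v, (Finset.mem_filter.mp hI).2, hv⟩
    · rw [Finset.sum_filter]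
  have h2 : c ≤ ∑ I with ¬ Disjoint I L, y I := by
    by_contra! h
    exact hL (hcov.mono h.le)
  have h3 := Finset.sum_filter_add_sum_filter_not Finset.univ (fun I => Disjoint I L) y
  linarith

/-- There is a choice of independent sets `f v` such that no initial segment of `A` contains large
sets `Q` and a set `R` for which all `f v` with `v ∈ Q` miss the neighbors of `v` in `R`, if these
are hard to color. -/
theorem exists_selection {G : SimpleGraph V} {r : V → α} (hr : Function.Injective r)
    {A : Finset V} {m m' : ℝ} (N : ℕ) (hm : 0 < m) (hmm : m - m' ≤ (1 / 16) ^ N * m)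
    (hA : ∀ v ∈ A, FracCoverable G (lowerNbrs G r A v) m) :
    ∃ f : V → Finset V, (∀ v, G.IsIndepSet (f v : Set V)) ∧
      ∀ a ∈ A, ∀ R ⊆ below r A a, ∀ Q ⊆ below r A a, (below r A a).card ≤ N * Q.card →
        (∀ v ∈ Q, ¬ FracCoverable G (lowerNbrs G r R v) m') →
        ∃ v ∈ Q, ∃ u ∈ lowerNbrs G r R v, u ∈ f v := by
  -- Outside A the empty set is colored instead, so that every vertex gets a distribution.
  have hA' : ∀ v, FracCoverable G (if v ∈ A then lowerNbrs G r A v else ∅) m := by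
    intro v
    split_ifs with hv
    exacts [hA v hv, fracCoverable_empty G hm.le]
  choose y h0 hi h1 hs using hA'
  -- A bad event is a triple (a, R, Q) for which every f v with v ∈ Q misses the lower neighbors of
  -- v in R. For a segment of size n it has probability at most 16⁻ⁿ, and there are at most 4ⁿ pairs
  -- (R, Q), which leaves 4⁻ⁿ.
  let T : Finset (Σ _ : V, Finset V × Finset V) :=
    (A.sigma fun a => (below r A a).powerset ×ˢ (below r A a).powerset).filter fun t =>
      (below r A t.1).card ≤ N * t.2.2.card ∧
        ∀ v ∈ t.2.2, ¬ FracCoverable G (lowerNbrs G r t.2.1 v) m'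
  have hbound : ∑ t ∈ T, ∏ v ∈ t.2.2,
      ∑ I with Disjoint I (lowerNbrs G r t.2.1 v), y v I / m < 1 := by
    calc ∑ t ∈ T, ∏ v ∈ t.2.2, ∑ I with Disjoint I (lowerNbrs G r t.2.1 v), y v I / m
        ≤ ∑ t ∈ T, (1 / 16 : ℝ) ^ (below r A t.1).card := by
          refine Finset.sum_le_sum fun t ht => ?_
          obtain ⟨ht1, ht2, ht3⟩ := Finset.mem_filter.mp ht
          simp only [Finset.mem_sigma, Finset.mem_product, Finset.mem_powerset] at ht1
          calc ∏ v ∈ t.2.2, ∑ I with Disjoint I (lowerNbrs G r t.2.1 v), y v I / m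
              ≤ ∏ _v ∈ t.2.2, (1 / 16 : ℝ) ^ N := by
                refine Finset.prod_le_prod
                  (fun v _ => Finset.sum_nonneg fun I _ => div_nonneg (h0 v I) hm.le)
                  fun v hv => ?_
                rw [← Finset.sum_div, div_le_iff₀ hm]
                refine le_trans (le_of_le_of_eq (sum_disjoint_le (h0 v) (hi v) ?_ (ht3 v hv))
                  (by rw [hs])) hmm
                intro u hu
                refine h1 v u ?_
                rw [if_pos (Finset.mem_filter.mp (ht1.2.2 hv)).1]
                have hsub : t.2.1 ⊆ A := ht1.2.1.trans (Finset.filter_subset _ _)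
                exact Finset.filter_subset_filter _ (Finset.filter_subset_filter _ hsub) hu
            _ = (1 / 16 : ℝ) ^ (N * t.2.2.card) := by rw [Finset.prod_const, pow_mul]
            _ ≤ (1 / 16 : ℝ) ^ (below r A t.1).card :=
                pow_le_pow_of_le_one (by norm_num) (by norm_num) ht2
      _ ≤ ∑ t ∈ A.sigma fun a => (below r A a).powerset ×ˢ (below r A a).powerset,
            (1 / 16 : ℝ) ^ (below r A t.1).card :=
          Finset.sum_le_sum_of_subset_of_nonneg (Finset.filter_subset _ _)
            fun t _ _ => by positivity
      _ = ∑ a ∈ A, (1 / 4 : ℝ) ^ (below r A a).card := by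
          rw [Finset.sum_sigma]
          refine Finset.sum_congr rfl fun a _ => ?_
          simp only [Finset.sum_const, Finset.card_product, Finset.card_powerset, nsmul_eq_mul]
          push_cast
          rw [← mul_pow, ← mul_pow]
          norm_num
      _ < 1 := sum_pow_card_below_lt_one r hr A
  obtain ⟨f, hf, hfT⟩ := exists_forall_exists_notMem (fun v I => y v I / m)
    (fun v I => div_nonneg (h0 v I) hm.le)
    (fun v => by rw [← Finset.sum_div, hs, div_self hm.ne']) T (fun t => t.2.2)
    (fun t v => Finset.univ.filter fun I => Disjoint I (lowerNbrs G r t.2.1 v)) hbound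
  refine ⟨f, fun v => hi v _ fun h => hf v (by simp [h]), ?_⟩
  intro a ha R hR Q hQ hcard hQR
  obtain ⟨v, hv, hvf⟩ := hfT ⟨a, R, Q⟩ (by simp [T, ha, hR, hQ, hcard]; exact hQR)
  simp only [Finset.mem_filter, Finset.mem_univ, true_and, Finset.not_disjoint_iff] at hvf
  obtain ⟨u, hu1, hu2⟩ := hvf
  exact ⟨v, hv, u, hu2, hu1⟩

/-- If all triangle-free subgraphs of `G` have small fractional chromatic number, then so do the
sets in which the lower neighborhoods have bounded fractional chromatic number, as far as it can be
seen from a weight function that decreases with the rank. -/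
theorem exists_isIndepSet_sum_le {G : SimpleGraph V} {r : V → α} (hr : Function.Injective r)
    {x q : ℝ} {N : ℕ} (hx : 1 ≤ x) (hN : 2 * x ≤ N) (hq0 : 0 < q)
    (hq : q * (1 - (1 / 16) ^ N) = 1)
    (hG : ∀ H ≤ G, H.CliqueFree 3 → FracCoverable H Finset.univ x)
    {w : V → ℝ} (hw0 : ∀ v, 0 ≤ w v) (hw : ∀ u v, r u ≤ r v → w v ≤ w u) (i : ℕ) :
    ∀ A : Finset V, (∀ v ∈ A, FracCoverable G (lowerNbrs G r A v) (q ^ i / 2)) →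
      ∃ I ⊆ A, G.IsIndepSet (I : Set V) ∧ ∑ v ∈ A, w v ≤ (2 * x) ^ i * ∑ v ∈ I, w v := by
  induction i with
  | zero =>
    intro A hA
    refine ⟨A, Finset.Subset.refl A, ?_, by simp⟩
    -- Here the bound q ^ 0 / 2 is below 1, so lower neighborhoods are empty.
    have hlow : ∀ a ∈ A, ∀ b ∈ A, G.Adj a b → ¬ r b < r a := by
      intro a ha b hb hadj hlt
      have := (hA a ha).one_le (v := b) (by simp [lowerNbrs, hb, hlt, hadj])
      norm_num at this
    intro a ha b hb hab hadj
    rcases lt_or_gt_of_ne (hr.ne hab) with h | h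
    exacts [hlow b hb a ha hadj.symm h, hlow a ha b hb hadj h]
  | succ i ih =>
    intro A hA
    obtain ⟨f, hfi, hf⟩ := exists_selection hr (m' := q ^ i / 2) N (by positivity)
      (by
        have : q ^ i * (q * (1 - (1 / 16) ^ N)) = q ^ i := by rw [hq, mul_one]
        rw [pow_succ]
        linarith) hA
    obtain ⟨S, hSA, hS, hSw⟩ := FracCoverable.exists_weight_le (A := A)
      ((hG _ (selectGraph_le G r f) (selectGraph_cliqueFree hfi)).subset
        (Finset.subset_univ A)) w hw0
    obtain ⟨R, hRS, hR1, hR2⟩ := exists_greedy r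
      (fun v B => FracCoverable G (B.filter fun u => G.Adj v u) (q ^ i / 2)) S
    obtain ⟨I, hIR, hI, hIw⟩ := ih R hR1
    refine ⟨I, hIR.trans (hRS.trans hSA), hI, ?_⟩
    by_cases hwR : ∑ v ∈ S, w v ≤ 2 * ∑ v ∈ R, w v
    · calc ∑ v ∈ A, w v ≤ x * ∑ v ∈ S, w v := hSw
        _ ≤ x * (2 * ∑ v ∈ R, w v) := by gcongr
        _ ≤ x * (2 * ((2 * x) ^ i * ∑ v ∈ I, w v)) := by gcongr
        _ = (2 * x) ^ (i + 1) * ∑ v ∈ I, w v := by ring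
    exfalso
    push Not at hwR
    -- As R ⊆ S, g is 2x times the indicator of S \ R, minus 1. Its weighted sum is positive because
    -- S \ R has more than half the weight of S; by Abel summation some initial segment has positive
    -- sum as well.
    let g : V → ℝ := fun v => 2 * x * (if v ∈ S then 1 else 0) - 2 * x * (if v ∈ R then 1 else 0) - 1
    have hg : ∀ B : Finset V, ∑ v ∈ B, g v =
        2 * x * (B ∩ S).card - 2 * x * (B ∩ R).card - B.card := by
      intro B
      simp [g, Finset.sum_sub_distrib, Finset.sum_ite_mem, mul_comm]
    have hpos : 0 < ∑ v ∈ A, w v * g v := by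
      have : ∑ v ∈ A, w v * g v =
          2 * x * ∑ v ∈ S, w v - 2 * x * ∑ v ∈ R, w v - ∑ v ∈ A, w v := by
        have h1 : ∀ B ⊆ A, ∑ v ∈ B, w v = ∑ v ∈ A, if v ∈ B then w v else 0 := by
          intro B hB
          rw [Finset.sum_ite_mem, Finset.inter_eq_right.mpr hB]
        rw [h1 S hSA, h1 R (hRS.trans hSA), Finset.mul_sum, Finset.mul_sum,
          ← Finset.sum_sub_distrib, ← Finset.sum_sub_distrib]
        refine Finset.sum_congr rfl fun v _ => ?_
        simp only [g]
        split_ifs <;> ring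
      rw [this]
      nlinarith
    have hex : ∃ a ∈ A, 0 < ∑ b ∈ below r A a, g b := by
      by_contra! hcon
      have := sum_mul_le_mul_sum r hr w g hw A hcon 0 fun a _ => hw0 a
      linarith
    obtain ⟨a, ha, hga⟩ := hex
    rw [hg] at hga
    set P := below r A a with hP
    have hRSP : P ∩ R ⊆ P ∩ S := Finset.inter_subset_inter_left hRS
    have hcard := Finset.card_sdiff_add_card_eq_card hRSP
    have hcard' : (((P ∩ S) \ (P ∩ R)).card : ℝ) = (P ∩ S).card - (P ∩ R).card := by
      rw [← hcard]; push_cast; ring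
    obtain ⟨v, hv, u, hu, huf⟩ := hf a ha (P ∩ R) Finset.inter_subset_left
      ((P ∩ S) \ (P ∩ R)) (Finset.sdiff_subset.trans Finset.inter_subset_left)
      (by
        have h1 : (P.card : ℝ) ≤ 2 * x * ((P ∩ S) \ (P ∩ R)).card := by rw [hcard']; linarith
        have h2 : 2 * x * ((P ∩ S) \ (P ∩ R)).card ≤ (N : ℝ) * ((P ∩ S) \ (P ∩ R)).card := by
          gcongr
        exact_mod_cast h1.trans h2)
      (by
        intro v hv
        simp only [Finset.mem_sdiff, Finset.mem_inter, not_and] at hv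
        have := hR2 v hv.1.2 (hv.2 hv.1.1)
        -- Lower neighbors of v in R lie in the segment P automatically, because v does.
        convert this using 2
        ext u
        simp only [lowerNbrs, Finset.mem_filter, Finset.mem_inter]
        constructor
        · rintro ⟨⟨⟨h1, h2⟩, h3⟩, h4⟩
          exact ⟨⟨h2, h3⟩, h4⟩
        · rintro ⟨⟨h2, h3⟩, h4⟩
          have hvA : r v ≤ r a := (Finset.mem_filter.mp hv.1.1).2
          exact ⟨⟨⟨Finset.mem_filter.mpr ⟨hSA (hRS h2), h3.le.trans hvA⟩, h2⟩, h3⟩, h4⟩)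
    simp only [lowerNbrs, Finset.mem_filter, Finset.mem_inter] at hu
    simp only [Finset.mem_sdiff, Finset.mem_inter] at hv
    have hadj : (selectGraph G r f).Adj v u := ⟨hu.2, Or.inl ⟨hu.1.2, huf⟩⟩
    exact hS hv.1.2 (hRS hu.1.1.2) hadj.ne hadj

end Selection

/-! ### Induction on the clique number and conclusion -/

/-- If all triangle-free subgraphs of `G` have small fractional chromatic number and all
neighborhoods have bounded fractional chromatic number, then so has the whole graph. -/
theorem exists_fracCoverable_of_neighborhoods {x : ℝ} (hx : 1 ≤ x) (m : ℝ) :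
    ∃ k : ℝ, 0 < k ∧ ∀ (V : Type u) [Fintype V] (G : SimpleGraph V),
      (∀ H ≤ G, H.CliqueFree 3 → FracCoverable H Finset.univ x) →
      ∀ A : Finset V, (∀ v ∈ A, FracCoverable G (A.filter fun u => G.Adj v u) m) →
        FracCoverable G A k := by
  obtain ⟨N, hN⟩ := exists_nat_ge (2 * x)
  have hN0 : N ≠ 0 := by
    rintro rfl
    norm_num at hN
    linarith
  have h16 : ((1 : ℝ) / 16) ^ N < 1 := pow_lt_one₀ (by norm_num) (by norm_num) hN0
  have h16' : (0 : ℝ) < (1 / 16) ^ N := by positivity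
  set q : ℝ := (1 - (1 / 16) ^ N)⁻¹
  have hq : q * (1 - (1 / 16) ^ N) = 1 := inv_mul_cancel₀ (by linarith)
  have hq1 : 1 < q := (one_lt_inv₀ (by linarith)).mpr (by linarith)
  obtain ⟨i, hi⟩ := pow_unbounded_of_one_lt (2 * m) hq1
  refine ⟨(2 * x) ^ i, by positivity, fun V _ G hG A hA => ?_⟩
  by_contra hcon
  obtain ⟨w, hw0, hw⟩ := exists_weight_of_not_fracCoverable (by positivity) hcon
  -- Rank by decreasing weight; an enumeration of V breaks ties to make the rank injective.
  let r : V → ℝ ×ₗ Fin (Fintype.card V) := fun v => toLex (-w v, Fintype.equivFin V v)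
  have hr : Function.Injective r := fun u v h => by
    have := congrArg (fun z => (ofLex z).2) h
    simpa [r] using this
  obtain ⟨I, -, hI, hIw⟩ := exists_isIndepSet_sum_le hr hx hN (by linarith) hq hG hw0
    (fun u v h => by
      rcases Prod.Lex.toLex_le_toLex.mp h with h | h
      · exact (neg_lt_neg_iff.mp h).le
      · exact (neg_inj.mp h.1).ge) i A
    (fun v hv => ((hA v hv).subset
      (Finset.filter_subset_filter _ (Finset.filter_subset _ _))).mono (by linarith))
  exact absurd (hw I hI) (not_lt.mpr hIw)

/-- A neighborhood that is hard to color contains a p-clique, which its center extends; if there is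
none, the neighborhood lemma bounds the whole set. -/
theorem exists_fracCoverable_or_isNClique {x : ℝ} (hx : 1 ≤ x) (p : ℕ) :
    ∃ k : ℝ, 0 < k ∧ ∀ (V : Type u) [Fintype V] (G : SimpleGraph V),
      (∀ H ≤ G, H.CliqueFree 3 → FracCoverable H Finset.univ x) →
      ∀ A : Finset V, FracCoverable G A k ∨ ∃ K ⊆ A, G.IsNClique p K := by
  induction p with
  | zero => exact ⟨1, one_pos, fun V _ G _ A => Or.inr ⟨∅, by simp, by simp⟩⟩
  | succ p ih =>
    obtain ⟨m, -, hm⟩ := ih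
    obtain ⟨k, hk0, hk⟩ := exists_fracCoverable_of_neighborhoods.{u} hx m
    refine ⟨k, hk0, fun V _ G hG A => ?_⟩
    by_cases hA : ∀ v ∈ A, FracCoverable G (A.filter fun u => G.Adj v u) m
    · exact Or.inl (hk V G hG A hA)
    · push Not at hA
      obtain ⟨v, hv, hvm⟩ := hA
      obtain ⟨K, hKA, hK⟩ := (hm V G hG _).resolve_left hvm
      refine Or.inr ⟨insert v K, Finset.insert_subset hv (hKA.trans (Finset.filter_subset _ _)), ?_⟩
      exact hK.insert fun u hu => (Finset.mem_filter.mp (hKA hu)).2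

/-- There are p³ vertices and independent sets have size at most 2p², so weight at least p/2 is
needed. -/
theorem not_fracCoverable_flagGraph {p : ℕ} [Fact p.Prime] {x : ℝ} (hx : 0 ≤ x)
    (hp : 2 * x < p) : ¬ FracCoverable (flagGraph p) Finset.univ x := by
  intro h
  obtain ⟨I, -, hI, hIw⟩ := h.exists_weight_le (fun _ => 1) fun _ => zero_le_one
  have h1 : (I.card : ℝ) ≤ 2 * p ^ 2 := by exact_mod_cast flagGraph_card_le p I hI
  have h2 : (p : ℝ) * (p * p) ≤ x * I.card := by simpa [ZMod.card] using hIw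
  have hp0 : (0 : ℝ) < p := by exact_mod_cast (Fact.out : p.Prime).pos
  have h3 : (p : ℝ) * (p * p) ≤ x * (2 * p ^ 2) := h2.trans (by gcongr)
  have h4 : 2 * x * (p * p) < p * (p * p) := by gcongr
  linarith

/-- A graph all of whose triangle-free subgraphs have small fractional chromatic number has bounded
fractional chromatic number. -/
theorem exists_fracCoverable {x : ℝ} (hx : 1 ≤ x) :
    ∃ k : ℝ, 0 < k ∧ ∀ (V : Type u) [Fintype V] (G : SimpleGraph V),
      (∀ H ≤ G, H.CliqueFree 3 → FracCoverable H Finset.univ x) →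
      FracCoverable G Finset.univ k := by
  obtain ⟨n, hn⟩ := exists_nat_gt (2 * x)
  obtain ⟨p, hnp, hp⟩ := Nat.exists_infinite_primes n
  have : Fact p.Prime := ⟨hp⟩
  have hpx : 2 * x < p := hn.trans_le (by exact_mod_cast hnp)
  obtain ⟨k, hk0, hk⟩ :=
    exists_fracCoverable_or_isNClique.{u} hx (Fintype.card (ZMod p × ZMod p × ZMod p))
  refine ⟨k, hk0, fun V _ G hG => (hk V G hG Finset.univ).resolve_right ?_⟩
  rintro ⟨K, -, hK⟩
  let e : (ZMod p × ZMod p × ZMod p) ≃ K := Fintype.equivOfCardEq (by simp [hK.card_eq])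
  let f : (ZMod p × ZMod p × ZMod p) ↪ V := e.toEmbedding.trans (Function.Embedding.subtype _)
  refine not_fracCoverable_flagGraph (by linarith) hpx
    ((hG ((flagGraph p).map f) ?_ ?_).of_injective f fun a b h => ?_)
  · rintro _ _ ⟨-, a, b, hab, rfl, rfl⟩
    exact hK.isClique (e a).2 (e b).2 fun h => hab.ne (f.injective h)
  · exact (SimpleGraph.cliqueFree_map_iff).mpr (flagGraph_cliqueFree p)
  · exact (SimpleGraph.map_adj_apply).mpr h

end FracChrom

theorem mainTheorem1 (x : ℝ) (hx : 1 ≤ x) :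
    ∃ k : ℝ, 0 < k ∧
      ∀ (V : Type*) [Finite V] (G : SimpleGraph V),
        k ≤ FracChrom.fractionalChromaticNumber G →
          ∃ H : G.Subgraph, H.coe.CliqueFree 3 ∧
            x ≤ FracChrom.fractionalChromaticNumber H.coe := by
  obtain ⟨k, hk0, hk⟩ := FracChrom.exists_fracCoverable hx
  -- The extra 1 makes the contradiction with χ_f ≤ k strict.
  refine ⟨k + 1, by linarith, fun V _ G hG => ?_⟩
  classical
  have := Fintype.ofFinite V
  by_contra! hcon
  refine absurd (hk V G fun H hHG hH => ?_).fractionalChromaticNumber_le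
    (not_le.mpr (by linarith))
  let H' := SimpleGraph.toSubgraph H hHG
  have := Fintype.ofFinite H'.verts
  have hfree : H'.coe.CliqueFree 3 :=
    hH.comap ⟨SimpleGraph.Embedding.toCopy
      (⟨⟨Subtype.val, Subtype.val_injective⟩, Iff.rfl⟩ : H'.coe ↪g H)⟩
  exact ((FracChrom.fracCoverable_fractionalChromaticNumber H'.coe).mono
    (hcon H' hfree).le).of_injective (fun v => ⟨v, trivial⟩) fun a b h => h
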